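/- Let $n\ge 4$ and put $s=n-4$. A \emph{symmetric triple} $(\mathfrak g,\sigma,B)$ is a finite-dimensional real Lie algebra $\mathfrak g$ with an involutive automorphism $\sigma$, whose eigenspace decomposition $\mathfrak g=\mathfrak h\oplus\mathfrak m$ (eigenvalues $1$ and $-1$) satisfies $\mathfrak h=[\mathfrak m,\mathfrak m]$, and a non-degenerate symmetric bilinear form $B$ on $\mathfrak g$ invariant under $\sigma$ and $\mathrm{ad}(\mathfrak g)$. An isomorphism of symmetric triples is an isomorphism of Lie algebras that commutes with the involutions and is isometric. The triple is \emph{decomposable} if $\mathfrak m$ contains a subspace, different from $\{0\}$ and $\mathfrak m$, on which $B$ is non-degenerate and which is invariant under $\mathrm{ad}(\mathfrak h)$; otherwise it is \emph{indecomposable}. For $r\in\{0,\dots,s\}$ and $\lambda=(\lambda_1,\lambda_2)$ with $\lambda_1,\lambda_2\in\mathbb R^{s}$ and $(\lambda_1^\alpha,\lambda_2^\alpha)\neq(0,0)$ for every $\alpha\in\{1,\dots,s\}$, set $\epsilon_\alpha=-1$ for $\alpha\le r$ and $\epsilon_\alpha=1$ for $\alpha>r$. Let $\tau_n(r,\lambda)$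 be the symmetric triple $\mathfrak h\oplus\mathfrak m$ with basis $W_1^*,\dots,W_s^*$ of $\mathfrak h$ and basis $Z_1,Z_2,W_1,\dots,W_s,Z_1^*,Z_2^*$ of $\mathfrak m$, with \[ B(W^*_\alpha,W^*_\beta)=\epsilon_\alpha\delta_{\alpha\beta},\qquad B(W_\alpha,W_\beta)=\delta_{\alpha\beta},\qquad B(Z_i,Z_j^*)=\delta_{ij}, \] all other products of basis vectors being zero, and with \[ [Z_i^*,W_\alpha]=\lambda_i^\alpha W_\alpha^*,\qquad [W_\alpha^*,Z_i^*]=\epsilon_\alpha\lambda_i^\alpha W_\alpha,\qquad [W_\alpha^*,W_\beta]=-\delta_{\alpha\beta}\,\epsilon_\alpha(\lambda_1^\alpha Z_1+\lambda_2^\alpha Z_2), \] all other brackets of basis vectors being zero, up to skew-symmetry. Let $P_\lambda=\mathrm{span}\{\lambda_1,\lambda_2\}\subset\mathbb R^s$. Let $\mathbb R^s$ carry its standard inner product and standard basis $e_1,\dots,e_s$, and let $E_S=\mathrm{span}\{e_\alpha:\alpha\in S\}$ for $S\subset\{1,\dots,s\}$. Let $\mathcal P_s$ be the set of all two-dimensional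 subspaces $P\subset\mathbb R^s$ such that (a) $P\not\subset e_\alpha^\perp$ for every $\alpha$, and (b) for every $S$ with $0<|S|<s$: if $P\cap E_S\neq\{0\}$, then $P\cap E_S^\perp=\{0\}$. The group generated by the coordinate permutations preserving $\{1,\dots,r\}$ and $\{r+1,\dots,s\}$ and by the sign changes of the coordinates, denoted $\mathcal S_r\times\mathcal S_{s-r}\times\{\pm1\}^{s}$, acts on $\mathcal P_s$; write $[P]$ for the orbit of $P$. \textbf{Proposition.} If $\tau_n(r,\lambda)$ is indecomposable, then $P_\lambda\in\mathcal P_s$, and $\tau_n(r,\lambda)\mapsto(r,[P_\lambda])$ induces a bijection from the set of isomorphism classes of indecomposable triples $\tau_n(r,\lambda)$ onto the set of pairs $(r,[P])$ with $r\in\{0,\dots,s\}$ and $[P]\in\mathcal P_s/(\mathcal S_r\times\mathcal S_{s-r}\times\{\pm1\}^{s})$. Its inverse is obtained by choosing any $\lambda_1,\lambda_2$ with $\mathrm{span}\{\lambda_1,\lambda_2\}=P$: for each such choice $(\lambda_1^\alpha,\lambda_2^\alpha)\ne(0,0)$ for all $\alpha$, the triple $\tau_n(r,\lambda)$ is indecomposable,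 and its class corresponds to $(r,[P])$. In particular, if an indecomposable triple $\tau_n(r,\lambda)$ exists, then $n>6$. -/

import Mathlib

noncomputable section

namespace SymTriples

/-! ### Symmetric triples, their isomorphisms, indecomposability -/

/-- A symmetric triple `(𝔤, σ, B)` on the real Lie algebra `𝔤`: an involutive automorphism `σ`,
with `𝔥` and `𝔪` its eigenspaces for `1` and `-1` and `𝔥 = [𝔪, 𝔪]`, and a non-degenerate symmetric
bilinear form `B` on `𝔤` invariant under `σ` and `ad 𝔤`. -/
structure SymmetricTriple (𝔤 : Type*) [LieRing 𝔤] [LieAlgebra ℝ 𝔤] where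
  finiteDimensional : FiniteDimensional ℝ 𝔤
  σ : 𝔤 ≃ₗ⁅ℝ⁆ 𝔤
  involutive : ∀ x, σ (σ x) = x
  B : LinearMap.BilinForm ℝ 𝔤
  symm : ∀ x y, B x y = B y x
  nondegenerate : ∀ x, (∀ y, B x y = 0) → x = 0
  σ_invariant : ∀ x y, B (σ x) (σ y) = B x y
  ad_invariant : ∀ x y z : 𝔤, B ⁅x, y⁆ z + B y ⁅x, z⁆ = 0
  bracket_span : ∀ x, σ x = x →
    x ∈ Submodule.span ℝ {z | ∃ u v : 𝔤, σ u = -u ∧ σ v = -v ∧ z = ⁅u, v⁆}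

namespace SymmetricTriple

variable {𝔤 𝔤₁ 𝔤₂ : Type*} [LieRing 𝔤] [LieAlgebra ℝ 𝔤] [LieRing 𝔤₁] [LieAlgebra ℝ 𝔤₁]
  [LieRing 𝔤₂] [LieAlgebra ℝ 𝔤₂]

/-- The `+1`-eigenspace `𝔥` of `σ`. -/
def h (τ : SymmetricTriple 𝔤) : Submodule ℝ 𝔤 where
  carrier := {x | τ.σ x = x}
  add_mem' := by
    intro a b ha hb
    simp only [Set.mem_ofPred_eq] at *
    rw [map_add, ha, hb]
  zero_mem' := by simp
  smul_mem' := by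
    intro c x hx
    simp only [Set.mem_ofPred_eq] at *
    rw [map_smul, hx]

/-- The `-1`-eigenspace `𝔪` of `σ`. -/
def m (τ : SymmetricTriple 𝔤) : Submodule ℝ 𝔤 where
  carrier := {x | τ.σ x = -x}
  add_mem' := by
    intro a b ha hb
    simp only [Set.mem_ofPred_eq] at *
    rw [map_add, ha, hb, neg_add]
  zero_mem' := by simp
  smul_mem' := by
    intro c x hx
    simp only [Set.mem_ofPred_eq] at *
    rw [map_smul, hx, smul_neg]

/-- `τ₁` and `τ₂` are isomorphic: there is an isomorphism of Lie algebras which intertwines the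
involutions and is isometric for the bilinear forms. -/
def Isomorphic (τ₁ : SymmetricTriple 𝔤₁) (τ₂ : SymmetricTriple 𝔤₂) : Prop :=
  ∃ Φ : 𝔤₁ ≃ₗ⁅ℝ⁆ 𝔤₂, (∀ x, Φ (τ₁.σ x) = τ₂.σ (Φ x)) ∧ ∀ x y, τ₂.B (Φ x) (Φ y) = τ₁.B x y

/-- `τ` is decomposable: `𝔪` has a proper (non-zero, not all of `𝔪`) subspace `V` that is invariant
under `ad 𝔥` and on which `B` is non-degenerate. -/
def Decomposable (τ : SymmetricTriple 𝔤) : Prop :=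
  ∃ V : Submodule ℝ 𝔤, V ≤ τ.m ∧ V ≠ ⊥ ∧ V ≠ τ.m ∧
    (∀ x ∈ V, (∀ y ∈ V, τ.B x y = 0) → x = 0) ∧
    ∀ a ∈ τ.h, ∀ x ∈ V, ⁅a, x⁆ ∈ V

/-- `τ` is indecomposable. -/
def Indecomposable (τ : SymmetricTriple 𝔤) : Prop := ¬ τ.Decomposable

theorem Isomorphic.refl (τ : SymmetricTriple 𝔤) : τ.Isomorphic τ :=
  ⟨LieEquiv.refl, fun _ => rfl, fun _ _ => rfl⟩

theorem Isomorphic.symm {τ₁ : SymmetricTriple 𝔤₁} {τ₂ : SymmetricTriple 𝔤₂}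
    (e : τ₁.Isomorphic τ₂) : τ₂.Isomorphic τ₁ := by
  obtain ⟨Φ, h1, h2⟩ := e
  refine ⟨Φ.symm, fun x => ?_, fun x y => ?_⟩
  · have := h1 (Φ.symm x)
    rw [LieEquiv.apply_symm_apply] at this
    rw [← this, LieEquiv.symm_apply_apply]
  · rw [← h2]
    simp

theorem Isomorphic.trans {τ₁ : SymmetricTriple 𝔤₁} {τ₂ : SymmetricTriple 𝔤₂}
    {τ₃ : SymmetricTriple 𝔤} (e : τ₁.Isomorphic τ₂) (f : τ₂.Isomorphic τ₃) :
    τ₁.Isomorphic τ₃ := by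
  obtain ⟨Φ, h1, h2⟩ := e
  obtain ⟨Ψ, k1, k2⟩ := f
  refine ⟨Φ.trans Ψ, fun x => ?_, fun x y => ?_⟩
  · simp [h1, k1]
  · simp [h2, k2]

end SymmetricTriple

/-! ### The normal form `τ_n(r, λ)`, with `s = n - 4` -/

/-- The signs `ε_α`: `-1` for the first `r` indices and `+1` for the others. -/
def eps {s : ℕ} (r : Fin (s + 1)) (α : Fin s) : ℝ := if α.val < r.val then -1 else 1

/-- The vector space `𝔥 ⊕ 𝔪` of `τ_n(r, λ)`. An element `(a, z, w, ζ)` stands for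
`∑ a_α W*_α + ∑ z_i Z_i + ∑ w_α W_α + ∑ ζ_i Z*_i`, the first summand being in `𝔥` and the
other three in `𝔪`. -/
def TauAlg {s : ℕ} (_r : Fin (s + 1)) (_lam : Fin 2 → EuclideanSpace ℝ (Fin s)) : Type :=
  (Fin s → ℝ) × (Fin 2 → ℝ) × (Fin s → ℝ) × (Fin 2 → ℝ)

namespace TauAlg

variable {s : ℕ} {r : Fin (s + 1)} {lam : Fin 2 → EuclideanSpace ℝ (Fin s)}

instance : AddCommGroup (TauAlg r lam) :=
  inferInstanceAs (AddCommGroup ((Fin s → ℝ) × (Fin 2 → ℝ) × (Fin s → ℝ) × (Fin 2 → ℝ)))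

instance : Module ℝ (TauAlg r lam) :=
  inferInstanceAs (Module ℝ ((Fin s → ℝ) × (Fin 2 → ℝ) × (Fin s → ℝ) × (Fin 2 → ℝ)))

instance : FiniteDimensional ℝ (TauAlg r lam) :=
  inferInstanceAs (FiniteDimensional ℝ ((Fin s → ℝ) × (Fin 2 → ℝ) × (Fin s → ℝ) × (Fin 2 → ℝ)))

/-- The coefficients at `W*_α`. -/
def wstar (x : TauAlg r lam) : Fin s → ℝ := x.1
/-- The coefficients at `Z_i`. -/
def z (x : TauAlg r lam) : Fin 2 → ℝ := x.2.1
/-- The coefficients at `W_α`. -/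
def w (x : TauAlg r lam) : Fin s → ℝ := x.2.2.1
/-- The coefficients at `Z*_i`. -/
def zstar (x : TauAlg r lam) : Fin 2 → ℝ := x.2.2.2

/-- The element with given coefficients. -/
def mk (a : Fin s → ℝ) (z : Fin 2 → ℝ) (w : Fin s → ℝ) (ζ : Fin 2 → ℝ) : TauAlg r lam :=
  (a, z, w, ζ)

@[simp] theorem wstar_mk (a z w ζ) : (mk a z w ζ : TauAlg r lam).wstar = a := rfl
@[simp] theorem z_mk (a z w ζ) : (mk a z w ζ : TauAlg r lam).z = z := rfl
@[simp] theorem w_mk (a z w ζ) : (mk a z w ζ : TauAlg r lam).w = w := rfl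
@[simp] theorem zstar_mk (a z w ζ) : (mk a z w ζ : TauAlg r lam).zstar = ζ := rfl
@[simp] theorem wstar_add (x y : TauAlg r lam) : (x + y).wstar = x.wstar + y.wstar := rfl
@[simp] theorem z_add (x y : TauAlg r lam) : (x + y).z = x.z + y.z := rfl
@[simp] theorem w_add (x y : TauAlg r lam) : (x + y).w = x.w + y.w := rfl
@[simp] theorem zstar_add (x y : TauAlg r lam) : (x + y).zstar = x.zstar + y.zstar := rfl
@[simp] theorem wstar_neg (x : TauAlg r lam) : (-x).wstar = -x.wstar := rfl
@[simp] theorem z_neg (x : TauAlg r lam) : (-x).z = -x.z := rfl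
@[simp] theorem w_neg (x : TauAlg r lam) : (-x).w = -x.w := rfl
@[simp] theorem zstar_neg (x : TauAlg r lam) : (-x).zstar = -x.zstar := rfl
@[simp] theorem wstar_zero : (0 : TauAlg r lam).wstar = 0 := rfl
@[simp] theorem z_zero : (0 : TauAlg r lam).z = 0 := rfl
@[simp] theorem w_zero : (0 : TauAlg r lam).w = 0 := rfl
@[simp] theorem zstar_zero : (0 : TauAlg r lam).zstar = 0 := rfl
@[simp] theorem wstar_smul (c : ℝ) (x : TauAlg r lam) : (c • x).wstar = c • x.wstar := rfl
@[simp] theorem z_smul (c : ℝ) (x : TauAlg r lam) : (c • x).z = c • x.z := rfl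
@[simp] theorem w_smul (c : ℝ) (x : TauAlg r lam) : (c • x).w = c • x.w := rfl
@[simp] theorem zstar_smul (c : ℝ) (x : TauAlg r lam) : (c • x).zstar = c • x.zstar := rfl

theorem ext {x y : TauAlg r lam} (h1 : ∀ α, x.wstar α = y.wstar α) (h2 : ∀ i, x.z i = y.z i)
    (h3 : ∀ α, x.w α = y.w α) (h4 : ∀ i, x.zstar i = y.zstar i) : x = y :=
  Prod.ext (funext h1) (Prod.ext (funext h2) (Prod.ext (funext h3) (funext h4)))

/-- The bilinear skew-symmetric extension of
`[Z*_i, W_α] = λ_i^α W*_α`, `[W*_α, Z*_i] = ε_α λ_i^α W_α`,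
`[W*_α, W_β] = - δ_{αβ} ε_α (λ_1^α Z_1 + λ_2^α Z_2)`, all other brackets of basis vectors
being zero. -/
instance : Bracket (TauAlg r lam) (TauAlg r lam) where
  bracket x y := mk
    (fun α => ∑ i, lam i α * (x.zstar i * y.w α - x.w α * y.zstar i))
    (fun i => ∑ α, -(eps r α * lam i α) * (x.wstar α * y.w α - x.w α * y.wstar α))
    (fun α => ∑ i, eps r α * lam i α * (x.wstar α * y.zstar i - x.zstar i * y.wstar α))
    0

theorem wstar_lie (x y : TauAlg r lam) (α : Fin s) :
    ⁅x, y⁆.wstar α = ∑ i, lam i α * (x.zstar i * y.w α - x.w α * y.zstar i) := rfl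
theorem z_lie (x y : TauAlg r lam) (i : Fin 2) :
    ⁅x, y⁆.z i =
      ∑ α, -(eps r α * lam i α) * (x.wstar α * y.w α - x.w α * y.wstar α) := rfl
theorem w_lie (x y : TauAlg r lam) (α : Fin s) :
    ⁅x, y⁆.w α =
      ∑ i, eps r α * lam i α * (x.wstar α * y.zstar i - x.zstar i * y.wstar α) := rfl
@[simp] theorem zstar_lie (x y : TauAlg r lam) : ⁅x, y⁆.zstar = 0 := rfl

instance : LieRing (TauAlg r lam) where
  add_lie x y u := by
    apply ext <;> intro i <;>
      simp only [wstar_lie, z_lie, w_lie, zstar_lie, wstar_add, z_add, w_add, zstar_add,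
        Pi.add_apply, ← Finset.sum_add_distrib, Pi.zero_apply, add_zero] <;>
      (apply Finset.sum_congr rfl; intros; ring)
  lie_add x y u := by
    apply ext <;> intro i <;>
      simp only [wstar_lie, z_lie, w_lie, zstar_lie, wstar_add, z_add, w_add, zstar_add,
        Pi.add_apply, ← Finset.sum_add_distrib, Pi.zero_apply, add_zero] <;>
      (apply Finset.sum_congr rfl; intros; ring)
  lie_self x := by
    apply ext <;> intro i <;>
      simp only [wstar_lie, z_lie, w_lie, zstar_lie, wstar_zero, z_zero, w_zero, zstar_zero,
        Pi.zero_apply] <;>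
      (apply Finset.sum_eq_zero; intros; ring)
  leibniz_lie x y u := by
    apply ext <;> intro i <;>
      simp only [wstar_lie, z_lie, w_lie, zstar_lie, wstar_add, z_add, w_add, zstar_add,
        Pi.add_apply, ← Finset.sum_add_distrib, Pi.zero_apply, add_zero, Fin.sum_univ_two] <;>
      first | ring1 | (apply Finset.sum_congr rfl; intros; ring)

instance : LieAlgebra ℝ (TauAlg r lam) where
  lie_smul c x y := by
    apply ext <;> intro i <;>
      simp only [wstar_lie, z_lie, w_lie, zstar_lie, wstar_smul, z_smul, w_smul, zstar_smul,
        Pi.smul_apply, smul_eq_mul, Finset.mul_sum, Pi.zero_apply, mul_zero] <;>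
      (apply Finset.sum_congr rfl; intros; ring)

/-- The involution: `1` on `𝔥 = span {W*_α}` and `-1` on `𝔪`. -/
def sigma : TauAlg r lam ≃ₗ⁅ℝ⁆ TauAlg r lam where
  toFun x := mk x.wstar (-x.z) (-x.w) (-x.zstar)
  invFun x := mk x.wstar (-x.z) (-x.w) (-x.zstar)
  map_add' x y := by
    apply ext <;> intro i <;> simp <;> ring
  map_smul' c x := by
    apply ext <;> intro i <;> simp
  map_lie' {x y} := by
    apply ext <;> intro i <;>
      simp [wstar_lie, z_lie, w_lie, ← Finset.sum_neg_distrib] <;>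
      first | ring1 | (apply Finset.sum_congr rfl; intros; ring)
  left_inv x := by
    apply ext <;> intro i <;> simp
  right_inv x := by
    apply ext <;> intro i <;> simp

theorem sigma_apply (x : TauAlg r lam) : sigma x = mk x.wstar (-x.z) (-x.w) (-x.zstar) := rfl

/-- The bilinear form: `𝔥 ⊥ 𝔪`; on `𝔥` it is `diag(ε_1, …, ε_{n-4})`; on `𝔪` the `W_α` are
orthonormal and perpendicular to all `Z_i`, `Z*_i`, and
`B(Z_i, Z*_j) = δ_{ij}`, `B(Z_i, Z_j) = B(Z*_i, Z*_j) = 0`. -/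
def form : LinearMap.BilinForm ℝ (TauAlg r lam) :=
  LinearMap.mk₂ ℝ
    (fun x y => ∑ α, eps r α * x.wstar α * y.wstar α + ∑ α, x.w α * y.w α
      + ∑ i, (x.z i * y.zstar i + x.zstar i * y.z i))
    (by
      intro x y u
      simp only [wstar_add, z_add, w_add, zstar_add, Pi.add_apply, add_mul, mul_add,
        Finset.sum_add_distrib]
      ring)
    (by
      intro c x u
      simp only [wstar_smul, z_smul, w_smul, zstar_smul, Pi.smul_apply, smul_eq_mul, mul_add,
        Finset.mul_sum]
      congr 1
      · congr 1 <;> (apply Finset.sum_congr rfl; intros; ring)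
      · apply Finset.sum_congr rfl; intros; ring)
    (by
      intro x y u
      simp only [wstar_add, z_add, w_add, zstar_add, Pi.add_apply, mul_add,
        Finset.sum_add_distrib]
      ring)
    (by
      intro c x u
      simp only [wstar_smul, z_smul, w_smul, zstar_smul, Pi.smul_apply, smul_eq_mul, mul_add,
        Finset.mul_sum]
      congr 1
      · congr 1 <;> (apply Finset.sum_congr rfl; intros; ring)
      · apply Finset.sum_congr rfl; intros; ring)

theorem form_apply (x y : TauAlg r lam) :
    form x y = ∑ α, eps r α * x.wstar α * y.wstar α + ∑ α, x.w α * y.w α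
      + ∑ i, (x.z i * y.zstar i + x.zstar i * y.z i) := rfl

theorem eps_ne_zero (r : Fin (s + 1)) (α : Fin s) : eps r α ≠ 0 := by
  unfold eps; split_ifs <;> norm_num

end TauAlg

/-- The condition `(λ_1^α, λ_2^α) ≠ 0` for all `α`. -/
def NonvanishingRows {s : ℕ} (lam : Fin 2 → EuclideanSpace ℝ (Fin s)) : Prop :=
  ∀ α, ¬ (lam 0 α = 0 ∧ lam 1 α = 0)

open TauAlg in
/-- The symmetric triple `τ_n(r, λ)`, `n = s + 4`. -/
def tau {s : ℕ} (r : Fin (s + 1)) (lam : Fin 2 → EuclideanSpace ℝ (Fin s))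
    (hlam : NonvanishingRows lam) : SymmetricTriple (TauAlg r lam) where
  finiteDimensional := inferInstance
  σ := sigma
  involutive x := by
    apply TauAlg.ext <;> intro i <;> simp [sigma_apply]
  B := form
  symm x y := by
    rw [form_apply, form_apply]
    congr 1
    · congr 1 <;> (apply Finset.sum_congr rfl; intros; ring)
    · apply Finset.sum_congr rfl; intros; ring
  nondegenerate x hx := by
    apply TauAlg.ext <;> intro i
    · have := hx (mk (Pi.single i 1) 0 0 0)
      simpa [form_apply, Pi.single_apply, eps_ne_zero] using this
    · have := hx (mk 0 0 0 (Pi.single i 1))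
      simpa [form_apply, Pi.single_apply] using this
    · have := hx (mk 0 0 (Pi.single i 1) 0)
      simpa [form_apply, Pi.single_apply] using this
    · have := hx (mk 0 (Pi.single i 1) 0 0)
      simpa [form_apply, Pi.single_apply] using this
  σ_invariant x y := by
    simp [form_apply, sigma_apply]
  ad_invariant x y u := by
    simp only [form_apply, wstar_lie, z_lie, w_lie, zstar_lie, Fin.sum_univ_two, Pi.zero_apply,
      mul_zero, zero_mul, add_zero, zero_add, Finset.sum_mul, Finset.mul_sum,
      ← Finset.sum_add_distrib]
    apply Finset.sum_eq_zero
    intros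
    ring
  bracket_span x hx := by
    have key : ∀ α : Fin s, (mk (Pi.single α 1) 0 0 0 : TauAlg r lam) ∈ Submodule.span ℝ
        {z | ∃ u v : TauAlg r lam, sigma u = -u ∧ sigma v = -v ∧ z = ⁅u, v⁆} := by
      intro α
      have hi : ∃ i, lam i α ≠ 0 := by
        by_contra hcon
        push Not at hcon
        exact hlam α ⟨hcon 0, hcon 1⟩
      obtain ⟨i, hi⟩ := hi
      have hb : ⁅(mk 0 0 0 (Pi.single i 1) : TauAlg r lam), mk 0 0 (Pi.single α 1) 0⁆
          ∈ Submodule.span ℝ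
          {z | ∃ u v : TauAlg r lam, sigma u = -u ∧ sigma v = -v ∧ z = ⁅u, v⁆} := by
        apply Submodule.subset_span
        refine ⟨_, _, ?_, ?_, rfl⟩ <;> (apply TauAlg.ext <;> intro i <;> simp [sigma_apply])
      have he : (mk (Pi.single α 1) 0 0 0 : TauAlg r lam) =
          (lam i α)⁻¹ • ⁅(mk 0 0 0 (Pi.single i 1) : TauAlg r lam), mk 0 0 (Pi.single α 1) 0⁆ := by
        apply TauAlg.ext <;> intro j
        · by_cases hj : j = α
          · subst hj
            simp [wstar_lie, Pi.single_apply, hi]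
          · simp [wstar_lie, Pi.single_apply, hj]
        · simp [z_lie]
        · simp [w_lie]
        · simp
      rw [he]
      exact Submodule.smul_mem _ _ hb
    have hsum : x = ∑ α, x.wstar α • (mk (Pi.single α 1) 0 0 0 : TauAlg r lam) := by
      have e1 : ∀ f : Fin s → TauAlg r lam, (∑ α, f α).wstar = ∑ α, (f α).wstar := fun f =>
        map_sum (⟨⟨wstar, rfl⟩, fun _ _ => rfl⟩ : TauAlg r lam →+ (Fin s → ℝ)) f _
      have e2 : ∀ f : Fin s → TauAlg r lam, (∑ α, f α).z = ∑ α, (f α).z := fun f =>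
        map_sum (⟨⟨z, rfl⟩, fun _ _ => rfl⟩ : TauAlg r lam →+ (Fin 2 → ℝ)) f _
      have e3 : ∀ f : Fin s → TauAlg r lam, (∑ α, f α).w = ∑ α, (f α).w := fun f =>
        map_sum (⟨⟨w, rfl⟩, fun _ _ => rfl⟩ : TauAlg r lam →+ (Fin s → ℝ)) f _
      have e4 : ∀ f : Fin s → TauAlg r lam, (∑ α, f α).zstar = ∑ α, (f α).zstar := fun f =>
        map_sum (⟨⟨zstar, rfl⟩, fun _ _ => rfl⟩ : TauAlg r lam →+ (Fin 2 → ℝ)) f _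
      have n2 : ∀ i, x.z i = 0 := fun i => by
        have := congrFun (congrArg TauAlg.z hx) i
        simp [sigma_apply] at this
        linarith
      have n3 : ∀ i, x.w i = 0 := fun i => by
        have := congrFun (congrArg TauAlg.w hx) i
        simp [sigma_apply] at this
        linarith
      have n4 : ∀ i, x.zstar i = 0 := fun i => by
        have := congrFun (congrArg TauAlg.zstar hx) i
        simp [sigma_apply] at this
        linarith
      apply TauAlg.ext <;> intro j
      · simp [e1, Finset.sum_apply, Pi.single_apply]
      · simp [e2, n2]
      · simp [e3, n3]
      · simp [e4, n4]
    rw [hsum]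
    exact Submodule.sum_mem _ fun α _ => Submodule.smul_mem _ _ (key α)

/-- The parameters `(r, λ)` of the indecomposable triples among the `τ_n(r, λ)`, `n = s + 4`. -/
structure IndecParam (s : ℕ) where
  r : Fin (s + 1)
  lam : Fin 2 → EuclideanSpace ℝ (Fin s)
  nonvanishing : NonvanishingRows lam
  indecomposable : (tau r lam nonvanishing).Indecomposable

/-- The triple `τ_n(r, λ)` belonging to a parameter. -/
def IndecParam.triple {s : ℕ} (p : IndecParam s) : SymmetricTriple (TauAlg p.r p.lam) :=
  tau p.r p.lam p.nonvanishing

/-- Isomorphism of the triples `τ_n(r, λ)`. -/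
def isoSetoid (s : ℕ) : Setoid (IndecParam s) where
  r p q := p.triple.Isomorphic q.triple
  iseqv := ⟨fun _ => .refl _, fun e => e.symm, fun e f => e.trans f⟩

/-- The isomorphism classes of indecomposable triples `τ_n(r, λ)`, `n = s + 4`. -/
abbrev IsoClass (s : ℕ) : Type := Quotient (isoSetoid s)

/-! ### The moduli space of planes -/

/-- The standard basis vector `e_α`. -/
def stdVec {s : ℕ} (α : Fin s) : EuclideanSpace ℝ (Fin s) := EuclideanSpace.single α 1

/-- The coordinate subspace `E_S = span {e_α | α ∈ S}`. -/
def coordSubspace {s : ℕ} (S : Set (Fin s)) : Submodule ℝ (EuclideanSpace ℝ (Fin s)) :=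
  Submodule.span ℝ (stdVec '' S)

/-- The planes `P` of `ℝ^s` contained in no coordinate hyperplane `e_α^⊥` such that
`P ∩ E_S ≠ 0` implies `P ∩ E_S^⊥ = 0` for every set `S` of indices with `0 < |S| < s`. -/
def Admissible {s : ℕ} (P : Submodule ℝ (EuclideanSpace ℝ (Fin s))) : Prop :=
  Module.finrank ℝ P = 2 ∧ (∀ α, ¬ P ≤ (ℝ ∙ stdVec α)ᗮ) ∧
    ∀ S : Set (Fin s), S.Nonempty → S ≠ Set.univ →
      P ⊓ coordSubspace S ≠ ⊥ → P ⊓ (coordSubspace S)ᗮ = ⊥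

/-- The subtype of admissible planes. -/
def AdmissiblePlane (s : ℕ) : Type :=
  {P : Submodule ℝ (EuclideanSpace ℝ (Fin s)) // Admissible P}

/-- The linear map `e_α ↦ c_{π α} e_{π α}`, for a permutation `π` and signs `c`: the permutation
`e_α ↦ e_{π α}` followed by the reflections `e_β ↦ c_β e_β`. -/
def signedPerm {s : ℕ} (π : Equiv.Perm (Fin s)) (c : Fin s → ℤˣ) :
    EuclideanSpace ℝ (Fin s) →ₗ[ℝ] EuclideanSpace ℝ (Fin s) where
  toFun x := WithLp.toLp 2 fun β => ((c β : ℤ) : ℝ) * x (π.symm β)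
  map_add' x y := by ext β; simp [mul_add]
  map_smul' a x := by ext β; simp; ring

theorem signedPerm_apply {s : ℕ} (π : Equiv.Perm (Fin s)) (c : Fin s → ℤˣ)
    (x : EuclideanSpace ℝ (Fin s)) (β : Fin s) :
    signedPerm π c x β = ((c β : ℤ) : ℝ) * x (π.symm β) := rfl

theorem signedPerm_comp {s : ℕ} (π ρ : Equiv.Perm (Fin s)) (c d : Fin s → ℤˣ) :
    signedPerm ρ d ∘ₗ signedPerm π c =
      signedPerm (π.trans ρ) fun β => d β * c (ρ.symm β) := by
  ext x β
  simp [signedPerm_apply, mul_assoc]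

theorem signedPerm_one {s : ℕ} : signedPerm (Equiv.refl (Fin s)) 1 = LinearMap.id := by
  ext x β
  simp [signedPerm_apply]

/-- `P` and `P'` are in the same orbit of `S_r × S_{s-r} × {±1}^s`, where `S_r × S_{s-r}` are the
permutations of the coordinates preserving the set of the first `r` indices (hence also the set of
the last `s - r`), and `{±1}^s` acts by sign changes of the coordinates. -/
def SameOrbit {s : ℕ} (r : Fin (s + 1)) (P P' : Submodule ℝ (EuclideanSpace ℝ (Fin s))) : Prop :=
  ∃ (π : Equiv.Perm (Fin s)) (c : Fin s → ℤˣ),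
    (∀ α : Fin s, (π α).val < r.val ↔ α.val < r.val) ∧ P.map (signedPerm π c) = P'

/-- Being in the same orbit, as an equivalence relation on the admissible planes. -/
def orbitSetoid (s : ℕ) (r : Fin (s + 1)) : Setoid (AdmissiblePlane s) where
  r P P' := SameOrbit r P.1 P'.1
  iseqv := by
    refine ⟨fun P => ⟨Equiv.refl _, 1, fun _ => Iff.rfl, ?_⟩, ?_, ?_⟩
    · rw [signedPerm_one, Submodule.map_id]
    · rintro P P' ⟨π, c, h, e⟩
      refine ⟨π.symm, fun β => c (π β), fun α => ?_, ?_⟩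
      · simpa using (h (π.symm α)).symm
      · rw [← e, ← Submodule.map_comp, signedPerm_comp]
        have : signedPerm (π.trans π.symm)
            (fun β => c (π β) * c (π.symm.symm β)) = LinearMap.id := by
          rw [← signedPerm_one]
          congr 1
          · simp
          · ext β
            simp
        rw [this, Submodule.map_id]
    · rintro P P' P'' ⟨π, c, h, e⟩ ⟨ρ, d, k, f⟩
      refine ⟨π.trans ρ, fun β => d β * c (ρ.symm β), fun α => ?_, ?_⟩
      · simp [k, h]
      · rw [← signedPerm_comp, Submodule.map_comp, e, f]

/-- The pairs `(r, [P])`: `r ∈ {0, …, s}` and `[P]` an orbit of admissible planes under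
`S_r × S_{s-r} × {±1}^s`. -/
abbrev Moduli (s : ℕ) : Type := Σ r : Fin (s + 1), Quotient (orbitSetoid s r)

/-- The class `(r, [P])` of an admissible plane. -/
def Moduli.mk {s : ℕ} (r : Fin (s + 1)) (P : Submodule ℝ (EuclideanSpace ℝ (Fin s)))
    (hP : Admissible P) : Moduli s :=
  ⟨r, Quotient.mk (orbitSetoid s r) ⟨P, hP⟩⟩

/-- `P_λ = span {λ_1, λ_2}`. -/
def planeOf {s : ℕ} (lam : Fin 2 → EuclideanSpace ℝ (Fin s)) :
    Submodule ℝ (EuclideanSpace ℝ (Fin s)) :=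
  Submodule.span ℝ {lam 0, lam 1}

end SymTriples

end

namespace SymTriples

open TauAlg

variable {s : ℕ}

/-! Everything is expressed through `comb lam`, which sends `ζ`, the `Z*`-coordinates of an element,
to the vector `ζ_1 λ_1 + ζ_2 λ_2` of `P_λ`. Up to sign, `ad W*_α` sends `∑ ζ_i Z*_i` to the `α`-th
coordinate of that vector times `W_α`, and `W_α` to the row `λ^α` read as a combination of the
`Z_i`.

Indecomposability. If `λ_1, λ_2` are dependent, or if `P_λ` meets both `E_S` and `E_S^⊥`, then `ad
𝔥`-invariant non-degenerate subspaces can be written down (`decomposable_of_splitting`). Conversely,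
let `𝔪 = V ⊕ U` be an orthogonal invariant splitting. An element of `V` whose vector in `P_λ` has
non-zero `α`-th coordinate forces `W_α ∈ V` (`single_mem`), and likewise for `U`. With `S` the set
of `α` such that `W_α ∈ V`, the vectors coming from `V` lie in `E_S` and those from `U` in `E_S^⊥`.
Both occur non-trivially by `eq_bot`, so `P_λ` is not admissible.

Isomorphism. When `P_λ` is a plane, the centre is the span of the `Z_i`, so an isomorphism respects
the subspace `ζ = 0` perpendicular to it. The operators `ad Z*_ζ ad Z*_η` act on the `W_α`
diagonally, with eigenvalues the rank-one forms `-ε_α λ^α(ζ) λ^α(η)`. An isomorphism matches these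
forms up to a permutation. A signed rank-one form determines its sign and its linear form up to
sign, whence `r` and the orbit of `P_λ` (`exists_perm_of_isomorphic`). Conversely, a signed
permutation together with a change of basis of the plane lifts to an isomorphism
(`isomorphic_of_sameOrbit`). -/

/-! ### Linear algebra of `P_λ` and of the coordinate subspaces. -/

/-- The linear map `ζ ↦ ζ_1 λ_1 + ζ_2 λ_2`. -/
noncomputable def comb (lam : Fin 2 → EuclideanSpace ℝ (Fin s)) :
    (Fin 2 → ℝ) →ₗ[ℝ] EuclideanSpace ℝ (Fin s) where
  toFun ζ := ζ 0 • lam 0 + ζ 1 • lam 1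
  map_add' x y := by simp only [Pi.add_apply]; module
  map_smul' c x := by simp only [Pi.smul_apply, smul_eq_mul, RingHom.id_apply]; module

theorem comb_apply (lam : Fin 2 → EuclideanSpace ℝ (Fin s)) (ζ : Fin 2 → ℝ) (α : Fin s) :
    comb lam ζ α = ζ 0 * lam 0 α + ζ 1 * lam 1 α := rfl

theorem mem_planeOf {lam : Fin 2 → EuclideanSpace ℝ (Fin s)} {x : EuclideanSpace ℝ (Fin s)} :
    x ∈ planeOf lam ↔ ∃ ζ, comb lam ζ = x := by
  rw [planeOf, Submodule.mem_span_pair]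
  constructor
  · rintro ⟨a, b, rfl⟩
    exact ⟨![a, b], rfl⟩
  · rintro ⟨ζ, rfl⟩
    exact ⟨ζ 0, ζ 1, rfl⟩

theorem range_comb (lam : Fin 2 → EuclideanSpace ℝ (Fin s)) :
    LinearMap.range (comb lam) = planeOf lam := by
  ext x
  rw [mem_planeOf, LinearMap.mem_range]

/-- Rank-nullity for `comb lam`, whose range is `P_λ`. The injectivity on the right is the form in
which the dimension is used throughout. -/
theorem finrank_planeOf_eq_two_iff {lam : Fin 2 → EuclideanSpace ℝ (Fin s)} :
    Module.finrank ℝ (planeOf lam) = 2 ↔ ∀ ζ, comb lam ζ = 0 → ζ = 0 := by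
  rw [← range_comb, ← LinearMap.ker_eq_bot', ← Submodule.finrank_eq_zero (R := ℝ)]
  have := LinearMap.finrank_range_add_finrank_ker (comb lam)
  rw [Module.finrank_fin_fun] at this
  omega

theorem NonvanishingRows.exists_comb_ne_zero {lam : Fin 2 → EuclideanSpace ℝ (Fin s)}
    (h : NonvanishingRows lam) (α : Fin s) : ∃ ζ, comb lam ζ α ≠ 0 := by
  by_contra! hc
  exact h α ⟨by simpa [comb_apply] using hc ![1, 0], by simpa [comb_apply] using hc ![0, 1]⟩

theorem not_planeOf_le_orthogonal_iff {lam : Fin 2 → EuclideanSpace ℝ (Fin s)} {α : Fin s} :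
    ¬ planeOf lam ≤ (ℝ ∙ stdVec α)ᗮ ↔ ¬ (lam 0 α = 0 ∧ lam 1 α = 0) := by
  rw [planeOf, Submodule.span_le, Set.insert_subset_iff, Set.singleton_subset_iff,
    SetLike.mem_coe, SetLike.mem_coe, Submodule.mem_orthogonal_singleton_iff_inner_right,
    Submodule.mem_orthogonal_singleton_iff_inner_right]
  simp [stdVec, EuclideanSpace.inner_single_left]

theorem mem_coordSubspace {S : Set (Fin s)} {x : EuclideanSpace ℝ (Fin s)} :
    x ∈ coordSubspace S ↔ ∀ α ∉ S, x α = 0 := by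
  constructor
  · intro hx α hα
    induction hx using Submodule.span_induction with
    | mem y hy =>
      obtain ⟨β, hβ, rfl⟩ := hy
      have : α ≠ β := fun h => hα (h ▸ hβ)
      simp [stdVec, this]
    | zero => rfl
    | add y z _ _ hy hz => simp [hy, hz]
    | smul c y _ hy => simp [hy]
  · intro h
    have : x = ∑ α, x α • stdVec α := by
      ext β
      simp [stdVec, Pi.single_apply]
    rw [this]
    refine Submodule.sum_mem _ fun α _ => ?_
    by_cases hα : α ∈ S
    · exact Submodule.smul_mem _ _ (Submodule.subset_span ⟨α, hα, rfl⟩)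
    · simp [h α hα]

theorem mem_coordSubspace_orthogonal {S : Set (Fin s)} {x : EuclideanSpace ℝ (Fin s)} :
    x ∈ (coordSubspace S)ᗮ ↔ ∀ α ∈ S, x α = 0 := by
  rw [Submodule.mem_orthogonal]
  constructor
  · intro h α hα
    have := h (stdVec α) (Submodule.subset_span ⟨α, hα, rfl⟩)
    simpa [stdVec, EuclideanSpace.inner_single_left] using this
  · intro h u hu
    rw [mem_coordSubspace] at hu
    rw [PiLp.inner_apply]
    refine Finset.sum_eq_zero fun α _ => ?_
    by_cases hα : α ∈ S
    · simp [h α hα]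
    · simp [hu α hα]

/-- For `s = 2` the only plane is `ℝ²` itself, which contains both `e_0` and `e_1` and so violates
the splitting condition at `S = {0}`. This is the bound `n > 6`. -/
theorem Admissible.three_le {P : Submodule ℝ (EuclideanSpace ℝ (Fin s))} (hP : Admissible P) :
    3 ≤ s := by
  obtain ⟨h2, -, h3⟩ := hP
  have hle := Submodule.finrank_le P
  rw [finrank_euclideanSpace_fin, h2] at hle
  by_contra hs
  obtain rfl : s = 2 := by omega
  have htop : P = ⊤ := Submodule.eq_top_of_finrank_eq (by rw [h2, finrank_euclideanSpace_fin])
  subst htop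
  have hne : ∀ α : Fin 2, stdVec α ≠ 0 := fun α h => by
    have := congrArg (fun x => x α) h
    simp [stdVec] at this
  have := h3 {0} ⟨0, rfl⟩ (fun h => by simpa using Set.eq_univ_iff_forall.1 h 1) (by
    rw [top_inf_eq, Submodule.ne_bot_iff]
    exact ⟨stdVec 0, Submodule.subset_span ⟨0, rfl, rfl⟩, hne 0⟩)
  rw [top_inf_eq, Submodule.eq_bot_iff] at this
  exact hne 1 (this _ (mem_coordSubspace_orthogonal.2 (by simp [stdVec])))

/-! ### Brackets and the form in terms of `comb` -/

section TauAlg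

variable {r : Fin (s + 1)} {lam : Fin 2 → EuclideanSpace ℝ (Fin s)}

theorem eps_mul_self (r : Fin (s + 1)) (α : Fin s) : eps r α * eps r α = 1 := by
  unfold eps; split_ifs <;> norm_num

theorem wstar_lie_eq (x y : TauAlg r lam) (α : Fin s) :
    ⁅x, y⁆.wstar α = comb lam x.zstar α * y.w α - x.w α * comb lam y.zstar α := by
  rw [wstar_lie, Fin.sum_univ_two, comb_apply, comb_apply]
  ring

theorem w_lie_eq (x y : TauAlg r lam) (α : Fin s) :
    ⁅x, y⁆.w α =
      eps r α * (x.wstar α * comb lam y.zstar α - comb lam x.zstar α * y.wstar α) := by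
  rw [w_lie, Fin.sum_univ_two, comb_apply, comb_apply]
  ring

theorem mem_m_tau {hlam : NonvanishingRows lam} {x : TauAlg r lam} :
    x ∈ (tau r lam hlam).m ↔ x.wstar = 0 := by
  change sigma x = -x ↔ _
  constructor
  · intro h
    ext α
    have := congrFun (congrArg wstar h) α
    simp [sigma_apply] at this
    simp
    linarith
  · intro h
    apply TauAlg.ext <;> intro i <;> simp [sigma_apply, h]

theorem mem_h_tau {hlam : NonvanishingRows lam} {x : TauAlg r lam} :
    x ∈ (tau r lam hlam).h ↔ x.z = 0 ∧ x.w = 0 ∧ x.zstar = 0 := by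
  change sigma x = x ↔ _
  constructor
  · intro h
    refine ⟨?_, ?_, ?_⟩
    · ext i
      have := congrFun (congrArg z h) i
      simp [sigma_apply] at this
      simp
      linarith
    · ext i
      have := congrFun (congrArg w h) i
      simp [sigma_apply] at this
      simp
      linarith
    · ext i
      have := congrFun (congrArg zstar h) i
      simp [sigma_apply] at this
      simp
      linarith
  · rintro ⟨h1, h2, h3⟩
    apply TauAlg.ext <;> intro i <;> simp [sigma_apply, h1, h2, h3]

/-! ### Indecomposable triples have admissible planes. -/

/-- A splitting of the rows `λ^α` into those in the line `ℝ e` and those perpendicular to `c`, with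
`c` not perpendicular to `e`, decomposes `τ_n(r, λ)`. -/
theorem decomposable_of_splitting (hlam : NonvanishingRows lam) (S : Set (Fin s))
    (c e : Fin 2 → ℝ) (hce : c 0 * e 0 + c 1 * e 1 ≠ 0) (hc : ∀ α ∉ S, comb lam c α = 0)
    (he : ∀ α ∈ S, ∃ t : ℝ, ∀ i, lam i α = t * e i) :
    (tau r lam hlam).Decomposable := by
  have hc0 : c ≠ 0 := by rintro rfl; simp at hce
  -- `V` is spanned by `∑ e_i Z_i`, the `W_α` with `α ∈ S`, and `∑ c_i Z*_i`. The form is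
  -- non-degenerate on it because the first and the last pair to `c · e ≠ 0`.
  let V : Submodule ℝ (TauAlg r lam) :=
    { carrier := {x | x.wstar = 0 ∧ (∃ t : ℝ, x.z = t • e) ∧ (∀ α ∉ S, x.w α = 0) ∧
        ∃ t : ℝ, x.zstar = t • c}
      zero_mem' := ⟨rfl, ⟨0, by simp⟩, fun _ _ => rfl, ⟨0, by simp⟩⟩
      add_mem' := by
        rintro x y ⟨hx1, ⟨a, hx2⟩, hx3, ⟨b, hx4⟩⟩ ⟨hy1, ⟨a', hy2⟩, hy3, ⟨b', hy4⟩⟩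
        exact ⟨by simp [hx1, hy1], ⟨a + a', by simp [hx2, hy2, add_smul]⟩,
          fun α hα => by simp [hx3 α hα, hy3 α hα], ⟨b + b', by simp [hx4, hy4, add_smul]⟩⟩
      smul_mem' := by
        rintro k x ⟨hx1, ⟨a, hx2⟩, hx3, ⟨b, hx4⟩⟩
        exact ⟨by simp [hx1], ⟨k * a, by simp [hx2, mul_smul]⟩,
          fun α hα => by simp [hx3 α hα], ⟨k * b, by simp [hx4, mul_smul]⟩⟩ }
  refine ⟨V, fun x hx => mem_m_tau.2 hx.1, ?_, ?_, ?_, ?_⟩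
  · intro hV
    have : (mk 0 0 0 c : TauAlg r lam) ∈ V :=
      ⟨rfl, ⟨0, by simp⟩, fun _ _ => rfl, ⟨1, by simp⟩⟩
    rw [hV, Submodule.mem_bot] at this
    exact hc0 (congrArg zstar this)
  · intro hV
    have hm : ∀ ζ, ∃ t : ℝ, ζ = t • c := fun ζ => by
      have : (mk 0 0 0 ζ : TauAlg r lam) ∈ V := hV ▸ mem_m_tau.2 rfl
      exact this.2.2.2
    -- A vector perpendicular to `c` cannot be a multiple of `c ≠ 0`, so the `Z*`-part of `V` is a
    -- proper line.
    obtain ⟨t, ht⟩ := hm ![-(c 1), c 0]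
    have h0 := congrFun ht 0
    have h1 := congrFun ht 1
    simp at h0 h1
    have : c 0 * c 0 + c 1 * c 1 = 0 := by linear_combination c 0 * h1 - c 1 * h0
    apply hc0
    ext i
    fin_cases i <;> simp <;> nlinarith [mul_self_nonneg (c 0), mul_self_nonneg (c 1)]
  · rintro x ⟨hx1, ⟨a, hx2⟩, hx3, ⟨b, hx4⟩⟩ hx
    have e1 := hx (mk 0 e 0 0) ⟨rfl, ⟨1, by simp⟩, fun _ _ => rfl, ⟨0, by simp⟩⟩
    have e2 := hx (mk 0 0 0 c) ⟨rfl, ⟨0, by simp⟩, fun _ _ => rfl, ⟨1, by simp⟩⟩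
    change form _ _ = 0 at e1 e2
    simp only [form_apply, Fin.sum_univ_two] at e1 e2
    simp [hx2, hx4] at e1 e2
    have hb : b = 0 := by
      have : b * (c 0 * e 0 + c 1 * e 1) = 0 := by linear_combination e1
      exact (mul_eq_zero.1 this).resolve_right hce
    have ha : a = 0 := by
      have : a * (c 0 * e 0 + c 1 * e 1) = 0 := by linear_combination e2
      exact (mul_eq_zero.1 this).resolve_right hce
    apply TauAlg.ext <;> intro i
    · simp [hx1]
    · simp [hx2, ha]
    · by_cases hi : i ∈ S
      · have := hx (mk 0 0 (Pi.single i 1) 0) ⟨rfl, ⟨0, by simp⟩, fun α hα => by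
          have : α ≠ i := fun h => hα (h ▸ hi)
          simp [this], ⟨0, by simp⟩⟩
        change form _ _ = 0 at this
        simpa [form_apply, Pi.single_apply] using this
      · simp [hx3 i hi]
    · simp [hx4, hb]
  · rintro a ha x ⟨hx1, ⟨t, hx2⟩, hx3, ⟨b, hx4⟩⟩
    obtain ⟨ha1, ha2, ha3⟩ := mem_h_tau.1 ha
    choose! f hf using he
    refine ⟨?_, ⟨∑ α, -(eps r α * (a.wstar α * x.w α * f α)), ?_⟩, fun α hα => ?_, ⟨0, by simp⟩⟩
    · ext α
      simp [wstar_lie_eq, ha2, ha3]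
    · ext i
      simp only [z_lie, ha2, Pi.zero_apply, zero_mul, sub_zero, Pi.smul_apply, smul_eq_mul,
        Finset.sum_mul]
      refine Finset.sum_congr rfl fun α _ => ?_
      by_cases hα : α ∈ S
      · rw [hf α hα]; ring
      · rw [hx3 α hα]; ring
    · simp [w_lie_eq, ha3, hx4, hc α hα]

theorem admissible_of_indecomposable (hlam : NonvanishingRows lam)
    (hind : (tau r lam hlam).Indecomposable) : Admissible (planeOf lam) := by
  have h2 : Module.finrank ℝ (planeOf lam) = 2 := by
    rw [finrank_planeOf_eq_two_iff]
    intro c hc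
    by_contra hc0
    -- A relation `c` between `λ_1` and `λ_2` splits off the hyperbolic plane spanned by `∑ c_i Z_i`
    -- and `∑ c_i Z*_i`, on which `𝔥` acts trivially.
    refine hind (decomposable_of_splitting hlam ∅ c c (fun h => hc0 ?_) (by simp [hc]) (by simp))
    ext i
    fin_cases i <;> simp <;> nlinarith [mul_self_nonneg (c 0), mul_self_nonneg (c 1)]
  refine ⟨h2, fun α => not_planeOf_le_orthogonal_iff.2 (hlam α), fun S _ _ hS => ?_⟩
  rw [finrank_planeOf_eq_two_iff] at h2
  obtain ⟨u, ⟨hu1, hu2⟩, hu0⟩ := (Submodule.ne_bot_iff _).1 hS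
  obtain ⟨c, rfl⟩ := mem_planeOf.1 hu1
  rw [SetLike.mem_coe, mem_coordSubspace] at hu2
  rw [Submodule.eq_bot_iff]
  rintro v ⟨hv1, hv2⟩
  obtain ⟨d, rfl⟩ := mem_planeOf.1 hv1
  rw [SetLike.mem_coe, mem_coordSubspace_orthogonal] at hv2
  by_contra hv0
  -- For `α ∈ S` the row `λ^α` is perpendicular to `d`, hence a multiple of `d` rotated by a right
  -- angle, which serves as `e`. If `c · e = 0`, then `c` and `d` are proportional, and `comb lam c`
  -- would vanish on `S` as well as off it.
  refine hind (decomposable_of_splitting hlam S c ![-(d 1), d 0] ?_ hu2 ?_)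
  · intro h
    simp at h
    have hd : d ≠ 0 := by rintro rfl; simp at hv0
    have key : ∀ i, d i • comb lam c = c i • comb lam d := by
      intro i
      rw [← map_smul, ← map_smul]
      congr 1
      ext j
      fin_cases i <;> fin_cases j <;> simp <;> linarith
    obtain ⟨i, hi⟩ := Function.ne_iff.1 hd
    have : comb lam c = 0 := by
      ext α
      by_cases hα : α ∈ S
      · have := congrArg (fun x => x α) (key i)
        simp [hv2 α hα] at this
        exact this.resolve_left hi
      · exact hu2 α hα
    exact hu0 this
  · intro α hα
    have h1 := hv2 α hα
    rw [comb_apply] at h1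
    have hd : d 0 * d 0 + d 1 * d 1 ≠ 0 := by
      intro h
      apply hv0
      have : d = 0 := by
        ext i
        fin_cases i <;> simp <;> nlinarith [mul_self_nonneg (d 0), mul_self_nonneg (d 1)]
      simp [this]
    -- `t` is the coefficient of the orthogonal projection of `λ^α` to the rotated vector.
    obtain ⟨t, ht⟩ : ∃ t : ℝ, t * (d 0 * d 0 + d 1 * d 1) = d 0 * lam 1 α - d 1 * lam 0 α :=
      ⟨_, div_mul_cancel₀ _ hd⟩
    refine ⟨t, fun i => ?_⟩
    fin_cases i <;> simp <;> apply mul_right_cancel₀ hd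
    · linear_combination d 0 * h1 + d 1 * ht
    · linear_combination d 1 * h1 - d 0 * ht

/-! ### Admissible planes give indecomposable triples -/

/-- The subspaces `V` and `U` of `𝔪` are perpendicular, `ad 𝔥`-invariant and span `𝔪`. -/
structure OrthogonalSplitting (V U : Submodule ℝ (TauAlg r lam)) : Prop where
  left : ∀ x ∈ V, x.wstar = 0
  right : ∀ x ∈ U, x.wstar = 0
  ortho : ∀ x ∈ V, ∀ y ∈ U, form x y = 0
  left_lie : ∀ a, ∀ x ∈ V, ⁅(mk a 0 0 0 : TauAlg r lam), x⁆ ∈ V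
  right_lie : ∀ a, ∀ x ∈ U, ⁅(mk a 0 0 0 : TauAlg r lam), x⁆ ∈ U
  spans : ∀ x : TauAlg r lam, x.wstar = 0 → ∃ v ∈ V, ∃ u ∈ U, x = v + u

theorem form_comm (x y : TauAlg r lam) : form x y = form y x := by
  rw [form_apply, form_apply]
  congr 1
  · congr 1 <;> (apply Finset.sum_congr rfl; intros; ring)
  · apply Finset.sum_congr rfl; intros; ring

namespace OrthogonalSplitting

variable {V U : Submodule ℝ (TauAlg r lam)}

theorem swap (h : OrthogonalSplitting V U) : OrthogonalSplitting U V where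
  left := h.right
  right := h.left
  ortho x hx y hy := by rw [form_comm]; exact h.ortho y hy x hx
  left_lie := h.right_lie
  right_lie := h.left_lie
  spans x hx := by
    obtain ⟨v, hv, u, hu, rfl⟩ := h.spans x hx
    exact ⟨u, hu, v, hv, add_comm _ _⟩

/-- `[W*_α, x]` is a non-zero multiple of `W_α` plus a multiple of `∑ λ_i^α Z_i`. A second bracket
with `W*_α` leaves a non-zero multiple of `∑ λ_i^α Z_i` alone, which is used to cancel the `Z`-part
of the first. -/
theorem single_mem (h : OrthogonalSplitting V U) {x : TauAlg r lam} (hx : x ∈ V) {α : Fin s}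
    (hα : comb lam x.zstar α ≠ 0) : (TauAlg.mk 0 0 (Pi.single α 1) 0 : TauAlg r lam) ∈ V := by
  set a : TauAlg r lam := TauAlg.mk (Pi.single α 1) 0 0 0
  have h1 : ⁅a, x⁆ ∈ V := h.left_lie _ x hx
  have h2 : ⁅a, ⁅a, x⁆⁆ ∈ V := h.left_lie _ _ h1
  set k := comb lam x.zstar α
  have e : (TauAlg.mk 0 0 (Pi.single α 1) 0 : TauAlg r lam) =
      (eps r α * k⁻¹) • (⁅a, x⁆ - (eps r α * x.w α * k⁻¹) • ⁅a, ⁅a, x⁆⁆) := by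
    have hsub : ∀ x y : TauAlg r lam, x - y = x + (-1 : ℝ) • y := fun x y => by module
    have he := eps_mul_self r α
    rw [hsub]
    apply TauAlg.ext <;> intro i
    · simp [wstar_lie_eq, a]
    · simp [z_lie, w_lie_eq, a, Pi.single_apply]
      change _ = _ + eps r α * k⁻¹ *
        (eps r α * x.w α * k⁻¹ * (eps r α * lam i α * (eps r α * k)))
      have hk : k * k⁻¹ = 1 := mul_inv_cancel₀ hα
      linear_combination -(eps r α * eps r α * k⁻¹ * lam i α * x.w α) *
        (he + eps r α * eps r α * hk)
    · by_cases hi : i = α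
      · subst hi
        simp [w_lie_eq, a]
        change _ = eps r i * k⁻¹ * (eps r i * k)
        field_simp
        linarith
      · simp [w_lie_eq, a, hi]
    · simp
  rw [e]
  exact V.smul_mem _ (V.sub_mem h1 (V.smul_mem _ h2))

theorem exists_comb_ne_zero (h : OrthogonalSplitting V U) (hlam : NonvanishingRows lam)
    (α : Fin s) :
    (∃ x ∈ V, comb lam x.zstar α ≠ 0) ∨ ∃ y ∈ U, comb lam y.zstar α ≠ 0 := by
  obtain ⟨ζ, hζ⟩ := hlam.exists_comb_ne_zero α
  obtain ⟨v, hv, u, hu, e⟩ := h.spans (TauAlg.mk 0 0 0 ζ) rfl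
  by_contra! hc
  apply hζ
  have : ζ = v.zstar + u.zstar := congrArg zstar e
  rw [this, map_add, PiLp.add_apply, hc.1 v hv, hc.2 u hu, add_zero]

theorem form_single (x : TauAlg r lam) (α : Fin s) :
    form x (TauAlg.mk 0 0 (Pi.single α 1) 0) = x.w α := by
  simp [form_apply, Pi.single_apply]

/-- Otherwise `single_mem`, applied to `U`, puts `W_α` in `U` as well, although `B(W_α, W_α) = 1`.
-/
theorem comb_right_eq_zero (h : OrthogonalSplitting V U) {α : Fin s}
    (hα : (TauAlg.mk 0 0 (Pi.single α 1) 0 : TauAlg r lam) ∈ V) {y : TauAlg r lam} (hy : y ∈ U) :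
    comb lam y.zstar α = 0 := by
  by_contra hne
  have := h.ortho _ hα _ (h.swap.single_mem hy hne)
  simp [form_single] at this

/-- If `V` has no `Z*`-components, then `U` contains every `W_α` and its elements realise every
`Z*`-component. Orthogonality to `U` then kills first the `W`- and next the `Z`-components of `V`.
-/
theorem eq_bot (h : OrthogonalSplitting V U) (hlam : NonvanishingRows lam)
    (h0 : ∀ x ∈ V, x.zstar = 0) : V = ⊥ := by
  have hU : ∀ α, (TauAlg.mk 0 0 (Pi.single α 1) 0 : TauAlg r lam) ∈ U := by
    intro α
    rcases h.exists_comb_ne_zero hlam α with ⟨x, hx, hne⟩ | ⟨y, hy, hne⟩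
    · simp [h0 x hx] at hne
    · exact h.swap.single_mem hy hne
  rw [Submodule.eq_bot_iff]
  intro x hx
  have hw : x.w = 0 := by
    ext α
    rw [← form_single, h.ortho x hx _ (hU α)]
    rfl
  apply TauAlg.ext <;> intro i
  · simp [h.left x hx]
  · obtain ⟨v, hv, u, hu, e⟩ := h.spans (TauAlg.mk 0 0 0 (Pi.single i 1)) rfl
    have e' : u.zstar = Pi.single i 1 := by
      have := congrArg zstar e
      simpa [h0 v hv] using this.symm
    have := h.ortho x hx u hu
    simpa [form_apply, hw, h.left x hx, h0 x hx, e', Pi.single_apply] using this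
  · simp [hw]
  · simp [h0 x hx]

end OrthogonalSplitting

theorem Admissible.nonvanishingRows (hP : Admissible (planeOf lam)) : NonvanishingRows lam :=
  fun α => not_planeOf_le_orthogonal_iff.1 (hP.2.1 α)

theorem Admissible.indecomposable (hP : Admissible (planeOf lam)) (hlam : NonvanishingRows lam) :
    (tau r lam hlam).Indecomposable := by
  rintro ⟨V, hVm, hV0, hV1, hnd, hinv⟩
  have hrefl : (form (r := r) (lam := lam)).IsRefl := fun x y h => by rw [form_comm, h]
  -- Non-degeneracy on `V` gives a complement in all of `𝔤`. Intersecting it with `𝔪` still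
  -- complements `V` in `𝔪`, since `V ≤ 𝔪`.
  have hcompl : IsCompl V ((form (r := r) (lam := lam)).orthogonal V) := by
    rw [LinearMap.BilinForm.isCompl_orthogonal_iff_disjoint hrefl, Submodule.disjoint_def]
    intro x hx hx'
    refine hnd x hx fun y hy => ?_
    change form x y = 0
    rw [form_comm]
    exact LinearMap.BilinForm.mem_orthogonal_iff.1 hx' y hy
  set U : Submodule ℝ (TauAlg r lam) := (form (r := r) (lam := lam)).orthogonal V ⊓
    (tau r lam hlam).m with hU
  have hmh : ∀ a, (mk a 0 0 0 : TauAlg r lam) ∈ (tau r lam hlam).h := fun a =>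
    mem_h_tau.2 ⟨rfl, rfl, rfl⟩
  have hsplit : OrthogonalSplitting V U :=
    { left := fun x hx => mem_m_tau.1 (hVm hx)
      right := fun x hx => mem_m_tau.1 hx.2
      ortho := fun x hx y hy => LinearMap.BilinForm.mem_orthogonal_iff.1 hy.1 x hx
      left_lie := fun a x hx => hinv _ (hmh a) x hx
      right_lie := fun a x hx => by
        refine ⟨LinearMap.BilinForm.mem_orthogonal_iff.2 fun v hv => ?_, mem_m_tau.2 ?_⟩
        · have h1 := (tau r lam hlam).ad_invariant (mk a 0 0 0) v x
          have h2 := LinearMap.BilinForm.mem_orthogonal_iff.1 hx.1 _ (hinv _ (hmh a) v hv)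
          change form _ _ + form _ _ = 0 at h1
          change form _ _ = 0 at h2
          rw [h2, zero_add] at h1
          exact h1
        · ext α
          simp [wstar_lie_eq]
      spans := fun x hx => by
        obtain ⟨v, hv, u, hu, e⟩ := Submodule.mem_sup.1
          (hcompl.sup_eq_top ▸ Submodule.mem_top : x ∈ V ⊔ form.orthogonal V)
        refine ⟨v, hv, u, ⟨hu, ?_⟩, e.symm⟩
        rw [← add_sub_cancel_left v u, e]
        exact Submodule.sub_mem _ (mem_m_tau.2 hx) (hVm hv) }
  have hV : ∃ x ∈ V, x.zstar ≠ 0 := by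
    by_contra! hc
    exact hV0 (hsplit.eq_bot hlam hc)
  have hU : ∃ x ∈ U, x.zstar ≠ 0 := by
    by_contra! hc
    refine hV1 (le_antisymm hVm fun x hx => ?_)
    obtain ⟨v, hv, u, hu, rfl⟩ := hsplit.spans x (mem_m_tau.1 hx)
    rw [hsplit.swap.eq_bot hlam hc, Submodule.mem_bot] at hu
    simpa [hu] using hv
  obtain ⟨x, hx, hx0⟩ := hV
  obtain ⟨y, hy, hy0⟩ := hU
  have hinj := finrank_planeOf_eq_two_iff.1 hP.1
  -- This `S` violates admissibility: the vector of `x` lies in `E_S`, that of `y` in `E_S^⊥`, and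
  -- both are non-zero.
  set S : Set (Fin s) := {α | (mk 0 0 (Pi.single α 1) 0 : TauAlg r lam) ∈ V}
  have hxS : ∀ α ∉ S, comb lam x.zstar α = 0 := fun α hα => by
    by_contra hne
    exact hα (hsplit.single_mem hx hne)
  have hyS : ∀ α ∈ S, comb lam y.zstar α = 0 := fun α hα => hsplit.comb_right_eq_zero hα hy
  have hxne : comb lam x.zstar ≠ 0 := fun h => hx0 (hinj _ h)
  have hyne : comb lam y.zstar ≠ 0 := fun h => hy0 (hinj _ h)
  have hSne : S.Nonempty := by
    by_contra hS
    rw [Set.not_nonempty_iff_eq_empty] at hS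
    exact hxne (by ext α; exact hxS α (by simp [hS]))
  have hSuniv : S ≠ Set.univ := fun hS => hyne (by ext α; exact hyS α (by simp [hS]))
  have := hP.2.2 S hSne hSuniv ((Submodule.ne_bot_iff _).2
    ⟨_, ⟨mem_planeOf.2 ⟨_, rfl⟩, mem_coordSubspace.2 hxS⟩, hxne⟩)
  exact hyne ((Submodule.eq_bot_iff _).1 this _
    ⟨mem_planeOf.2 ⟨_, rfl⟩, mem_coordSubspace_orthogonal.2 hyS⟩)

end TauAlg

/-! ### Isomorphic triples have the same `r` and planes in the same orbit. -/

section Isomorphism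

variable {r r' : Fin (s + 1)} {lam lam' : Fin 2 → EuclideanSpace ℝ (Fin s)}

theorem lie_eq_zero_of_z (z : Fin 2 → ℝ) (y : TauAlg r lam) :
    ⁅(mk 0 z 0 0 : TauAlg r lam), y⁆ = 0 := by
  apply TauAlg.ext <;> intro i <;> simp [wstar_lie, z_lie, w_lie]

/-- If `P_λ` is a plane, the centre of `τ_n(r, λ)` is the span of the `Z_i`. -/
theorem eq_z_of_central (hinj : ∀ ζ, comb lam ζ = 0 → ζ = 0) (hlam : NonvanishingRows lam)
    {x : TauAlg r lam} (hx : ∀ y : TauAlg r lam, ⁅x, y⁆ = 0) : x = mk 0 x.z 0 0 := by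
  have hζ : x.zstar = 0 := hinj _ (by
    ext α
    have := congrFun (congrArg wstar (hx (mk 0 0 (Pi.single α 1) 0))) α
    simpa [wstar_lie_eq] using this)
  have h : ∀ α, x.wstar α = 0 ∧ x.w α = 0 := fun α => by
    obtain ⟨ζ, hne⟩ := hlam.exists_comb_ne_zero α
    have h1 := congrFun (congrArg wstar (hx (mk 0 0 0 ζ))) α
    have h2 := congrFun (congrArg w (hx (mk 0 0 0 ζ))) α
    simp [wstar_lie_eq, w_lie_eq, hne, eps_ne_zero] at h1 h2
    exact ⟨h2, h1⟩
  apply TauAlg.ext <;> intro i <;> simp [hζ, h]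

theorem form_z (x : TauAlg r lam) (i : Fin 2) :
    form x (mk 0 (Pi.single i 1) 0 0) = x.zstar i := by
  simp [form_apply, Pi.single_apply]

/-- The `i`-th `Z*`-coordinate is the pairing with `Z_i`. The preimage of `Z_i` under `Φ` is
central, hence a combination of the `Z_j`, and these are perpendicular to `x`. -/
theorem zstar_eq_zero_of_isometry (hinj : ∀ ζ, comb lam ζ = 0 → ζ = 0)
    (hlam : NonvanishingRows lam) (Φ : TauAlg r lam ≃ₗ⁅ℝ⁆ TauAlg r' lam')
    (hΦ : ∀ x y, form (Φ x) (Φ y) = form x y) {x : TauAlg r lam} (hx : x.zstar = 0) :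
    (Φ x).zstar = 0 := by
  ext i
  have hc := eq_z_of_central hinj hlam
    (x := Φ.symm (mk 0 (Pi.single i 1) 0 0)) fun y => by
      apply Φ.injective
      change Φ _ = Φ _
      rw [LieEquiv.map_lie, LieEquiv.apply_symm_apply, lie_eq_zero_of_z, map_zero]
  rw [← form_z, ← Φ.apply_symm_apply (mk 0 (Pi.single i 1) 0 0), hΦ, hc]
  simp [form_apply, hx]

theorem wstar_eq_zero_of_intertwines (Φ : TauAlg r lam ≃ₗ⁅ℝ⁆ TauAlg r' lam')
    (hσ : ∀ x, Φ (sigma x) = sigma (Φ x)) {x : TauAlg r lam} (hx : x.wstar = 0) :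
    (Φ x).wstar = 0 := by
  have h : sigma x = -x := by
    apply TauAlg.ext <;> intro i <;> simp [sigma_apply, hx]
  have := hσ x
  rw [h, map_neg] at this
  ext α
  have := congrFun (congrArg wstar this) α
  simp [sigma_apply] at this
  simp
  linarith

/-- The inclusion of the span of the `W_α`. -/
noncomputable def wIncl (r : Fin (s + 1)) (lam : Fin 2 → EuclideanSpace ℝ (Fin s)) :
    (Fin s → ℝ) →ₗ[ℝ] TauAlg r lam where
  toFun v := mk 0 0 v 0
  map_add' x y := by apply TauAlg.ext <;> intro i <;> simp
  map_smul' c x := by apply TauAlg.ext <;> intro i <;> simp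

/-- The inclusion of the span of the `Z*_i`. -/
noncomputable def zstarIncl (r : Fin (s + 1)) (lam : Fin 2 → EuclideanSpace ℝ (Fin s)) :
    (Fin 2 → ℝ) →ₗ[ℝ] TauAlg r lam where
  toFun v := mk 0 0 0 v
  map_add' x y := by apply TauAlg.ext <;> intro i <;> simp
  map_smul' c x := by apply TauAlg.ext <;> intro i <;> simp

/-- The coefficients at the `W_α`, as a linear map. -/
noncomputable def wProj (r : Fin (s + 1)) (lam : Fin 2 → EuclideanSpace ℝ (Fin s)) :
    TauAlg r lam →ₗ[ℝ] (Fin s → ℝ) where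
  toFun x := x.w
  map_add' _ _ := rfl
  map_smul' _ _ := rfl

/-- The coefficients at the `Z*_i`, as a linear map. -/
noncomputable def zstarProj (r : Fin (s + 1)) (lam : Fin 2 → EuclideanSpace ℝ (Fin s)) :
    TauAlg r lam →ₗ[ℝ] (Fin 2 → ℝ) where
  toFun x := x.zstar
  map_add' _ _ := rfl
  map_smul' _ _ := rfl

theorem lie_lie_wIncl (ζ η : Fin 2 → ℝ) (α : Fin s) :
    ⁅zstarIncl r lam ζ, ⁅zstarIncl r lam η, wIncl r lam (Pi.single α 1)⁆⁆ =
      -(eps r α * comb lam ζ α * comb lam η α) • wIncl r lam (Pi.single α 1) := by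
  apply TauAlg.ext <;> intro i
  · simp [wstar_lie_eq, w_lie_eq, zstarIncl, wIncl]
  · simp [z_lie, w_lie_eq, zstarIncl, wIncl]
  · by_cases hi : i = α
    · subst hi
      simp [wstar_lie_eq, w_lie_eq, zstarIncl, wIncl]
      ring
    · simp [wstar_lie_eq, w_lie_eq, zstarIncl, wIncl, hi]
  · simp [zstarIncl, wIncl]

/-- The image of `Z*_ζ` under an isomorphism may have `W`- and `Z`-components, and the image of
`W_α` may have `Z`-components; none of them affects these coefficients. -/
theorem w_lie_lie {x y u : TauAlg r lam} (hx : x.wstar = 0) (hu : u.zstar = 0)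
    (α : Fin s) : ⁅x, ⁅y, u⁆⁆.w α =
      -(eps r α * comb lam x.zstar α * comb lam y.zstar α) * u.w α := by
  simp [wstar_lie_eq, w_lie_eq, hx, hu]
  ring

/-- Some term of the Leibniz expansion is non-zero. -/
theorem exists_perm_of_det_ne_zero {ι : Type*} [Fintype ι] [DecidableEq ι] {M : Matrix ι ι ℝ}
    (hM : M.det ≠ 0) : ∃ π : Equiv.Perm ι, ∀ α, M (π α) α ≠ 0 := by
  by_contra! h
  apply hM
  rw [Matrix.det_apply]
  refine Finset.sum_eq_zero fun π _ => ?_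
  obtain ⟨α, hα⟩ := h π
  have h0 : ∏ i, M (π i) i = 0 := Finset.prod_eq_zero (Finset.mem_univ α) hα
  rw [h0, smul_zero]

theorem eps_eq_one_or (r : Fin (s + 1)) (α : Fin s) : eps r α = 1 ∨ eps r α = -1 := by
  unfold eps; split_ifs <;> simp

theorem eps_eq_neg_one_iff {r : Fin (s + 1)} {α : Fin s} : eps r α = -1 ↔ α.val < r.val := by
  unfold eps
  split_ifs with h
  · simp [h]
  · simp only [h, iff_false]; norm_num

/-- Rank-one forms `± u ⊗ u` determine the sign and `u` up to sign. -/
theorem eq_and_exists_sign {V : Type*} {ε ε' : ℝ} (hε : ε = 1 ∨ ε = -1)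
    (hε' : ε' = 1 ∨ ε' = -1) {u v : V → ℝ} {x₀ : V} (hu : u x₀ ≠ 0)
    (h : ∀ x y, ε * u x * u y = ε' * v x * v y) :
    ε = ε' ∧ ∃ c : ℤˣ, ∀ x, v x = ((c : ℤ) : ℝ) * u x := by
  have h0 := h x₀ x₀
  have hpos : 0 < u x₀ * u x₀ := mul_self_pos.2 hu
  have hε_eq : ε = ε' := by
    rcases hε with rfl | rfl <;> rcases hε' with rfl | rfl
    · rfl
    · nlinarith [mul_self_nonneg (v x₀)]
    · nlinarith [mul_self_nonneg (v x₀)]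
    · rfl
  subst hε_eq
  have hne : ε ≠ 0 := by rcases hε with rfl | rfl <;> norm_num
  have h' : ∀ x y, u x * u y = v x * v y := fun x y => by
    apply mul_left_cancel₀ hne
    linear_combination h x y
  refine ⟨rfl, ?_⟩
  rcases mul_self_eq_mul_self_iff.1 (h' x₀ x₀) with e | e
  · refine ⟨1, fun x => mul_left_cancel₀ hu ?_⟩
    have := h' x₀ x
    rw [← e] at this
    simp [this]
  · refine ⟨-1, fun x => mul_left_cancel₀ hu ?_⟩
    have := h' x₀ x
    have e' : v x₀ = -u x₀ := by linarith
    rw [e'] at this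
    simp [this]

theorem signedPerm_injective (π : Equiv.Perm (Fin s)) (c : Fin s → ℤˣ) :
    Function.Injective (signedPerm π c) := by
  rw [← LinearMap.ker_eq_bot, LinearMap.ker_eq_bot']
  intro x hx
  ext α
  have := congrArg (fun y => y (π α)) hx
  simp [signedPerm_apply] at this
  simpa using this

/-- Exactly `r` indices lie below `r`, because `r ≤ s`. -/
theorem eq_of_perm {π : Equiv.Perm (Fin s)}
    (h : ∀ α : Fin s, (π α).val < r'.val ↔ α.val < r.val) : r = r' := by
  have key : ∀ r : Fin (s + 1), Fintype.card {α : Fin s // α.val < r.val} = r.val := fun r => by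
    rw [Fintype.card_subtype, Fin.card_filter_val_lt]
    omega
  have := Fintype.card_congr (π.subtypeEquiv (p := fun α => α.val < r.val)
    (q := fun α => α.val < r'.val) fun α => (h α).symm)
  rw [key, key] at this
  exact Fin.ext this

theorem exists_perm_of_isomorphic {hlam : NonvanishingRows lam} {hlam' : NonvanishingRows lam'}
    (hfr : Module.finrank ℝ (planeOf lam) = 2) (hfr' : Module.finrank ℝ (planeOf lam') = 2)
    (e : (tau r lam hlam).Isomorphic (tau r' lam' hlam')) :
    ∃ (π : Equiv.Perm (Fin s)) (c : Fin s → ℤˣ),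
      (∀ α : Fin s, (π α).val < r'.val ↔ α.val < r.val) ∧
        (planeOf lam).map (signedPerm π c) = planeOf lam' := by
  obtain ⟨Φ, hσ, hB⟩ := e
  change ∀ x, Φ (sigma x) = sigma (Φ x) at hσ
  change ∀ x y, form (Φ x) (Φ y) = form x y at hB
  have hinj := finrank_planeOf_eq_two_iff.1 hfr
  let F : (Fin s → ℝ) →ₗ[ℝ] (Fin s → ℝ) :=
    wProj r' lam' ∘ₗ (Φ : TauAlg r lam →ₗ[ℝ] TauAlg r' lam') ∘ₗ wIncl r lam
  let T : (Fin 2 → ℝ) →ₗ[ℝ] (Fin 2 → ℝ) :=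
    zstarProj r' lam' ∘ₗ (Φ : TauAlg r lam →ₗ[ℝ] TauAlg r' lam') ∘ₗ zstarIncl r lam
  have hw : ∀ v, (Φ (wIncl r lam v)).wstar = 0 ∧ (Φ (wIncl r lam v)).zstar = 0 := fun v =>
    ⟨wstar_eq_zero_of_intertwines Φ hσ rfl, zstar_eq_zero_of_isometry hinj hlam Φ hB rfl⟩
  -- If `Φ` sends a combination of the `W_α` into the span of the `Z_i`, then that combination is
  -- central, hence zero.
  have hFinj : LinearMap.ker F = ⊥ := by
    rw [LinearMap.ker_eq_bot']
    intro v hv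
    have hΦ : Φ (wIncl r lam v) = mk 0 (Φ (wIncl r lam v)).z 0 0 := by
      have hv' : (Φ (wIncl r lam v)).w = 0 := hv
      apply TauAlg.ext <;> intro i <;> simp [hw v, hv']
    have := eq_z_of_central hinj hlam (x := wIncl r lam v) fun y => by
      apply Φ.injective
      change Φ _ = Φ _
      rw [LieEquiv.map_lie, hΦ, lie_eq_zero_of_z, map_zero]
    exact congrArg w this
  have hdet : (LinearMap.toMatrix' F).det ≠ 0 := by
    rw [LinearMap.det_toMatrix']
    exact (LinearMap.isUnit_det F ((LinearMap.isUnit_iff_ker_eq_bot F).2 hFinj)).ne_zero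
  obtain ⟨π, hπ⟩ := exists_perm_of_det_ne_zero hdet
  -- Compare the coefficients at `W_{π α}` in the image of `[Z*_ζ, [Z*_η, W_α]]`. The entry of `F`
  -- at `(π α, α)` is a non-zero common factor, so the eigenspaces need not be compared.
  have hrel : ∀ α ζ η, eps r α * comb lam ζ α * comb lam η α =
      eps r' (π α) * comb lam' (T ζ) (π α) * comb lam' (T η) (π α) := by
    intro α ζ η
    have hne := hπ α
    rw [LinearMap.toMatrix'_apply] at hne
    have h1 := congrArg (fun x => (Φ x).w (π α)) (lie_lie_wIncl (r := r) (lam := lam) ζ η α)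
    simp only [LieEquiv.map_lie, map_smul, w_smul, Pi.smul_apply, smul_eq_mul] at h1
    rw [w_lie_lie (wstar_eq_zero_of_intertwines Φ hσ rfl) (hw _).2] at h1
    have h2 := mul_right_cancel₀ hne h1
    exact (neg_injective h2).symm
  have hsign : ∀ α, eps r α = eps r' (π α) ∧ ∃ c : ℤˣ, ∀ ζ,
      comb lam' (T ζ) (π α) = ((c : ℤ) : ℝ) * comb lam ζ α := fun α => by
    obtain ⟨ζ₀, h0⟩ := hlam.exists_comb_ne_zero α
    exact eq_and_exists_sign (eps_eq_one_or r α) (eps_eq_one_or r' (π α))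
      (u := fun ζ => comb lam ζ α) (v := fun ζ => comb lam' (T ζ) (π α)) h0 (hrel α)
  choose heps c hc using hsign
  refine ⟨π, fun β => c (π.symm β), fun α => ?_, ?_⟩
  · rw [← eps_eq_neg_one_iff, ← eps_eq_neg_one_iff, heps]
  · apply Submodule.eq_of_le_of_finrank_eq
    · rintro _ ⟨x, hx, rfl⟩
      obtain ⟨ζ, rfl⟩ := mem_planeOf.1 hx
      refine mem_planeOf.2 ⟨T ζ, ?_⟩
      ext β
      obtain ⟨α, rfl⟩ := π.surjective β
      rw [hc, signedPerm_apply]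
      simp
    · rw [hfr', ← hfr]
      exact ((planeOf lam).equivMapOfInjective _ (signedPerm_injective _ _)).finrank_eq.symm

theorem exists_planeOf_eq {P : Submodule ℝ (EuclideanSpace ℝ (Fin s))}
    (hP : Module.finrank ℝ P = 2) : ∃ lam, planeOf lam = P := by
  let b := Module.finBasisOfFinrankEq ℝ P hP
  refine ⟨fun i => b i, ?_⟩
  have h := congrArg (Submodule.map P.subtype) b.span_eq
  rw [Submodule.map_span, Submodule.map_subtype_top, ← Set.range_comp] at h
  refine Eq.trans (congrArg (Submodule.span ℝ) ?_) h
  ext x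
  simp [Fin.exists_fin_two, eq_comm]

/-! ### Planes in the same orbit give isomorphic triples -/

theorem units_mul_self (u : ℤˣ) : ((u : ℤ) : ℝ) * ((u : ℤ) : ℝ) = 1 := by
  rcases Int.units_eq_one_or u with rfl | rfl <;> simp

theorem eps_perm {π : Equiv.Perm (Fin s)} (hπ : ∀ α : Fin s, (π α).val < r.val ↔ α.val < r.val)
    (α : Fin s) : eps r (π α) = eps r α := by
  unfold eps
  simp only [hπ]

/-- The isomorphism induced by a signed permutation `g` and a change of basis `A` of the plane,
where `λ'_i = g (∑_j A_{ij} λ_j)`. -/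
noncomputable def isoOfSignedPerm (π : Equiv.Perm (Fin s)) (c : Fin s → ℤˣ)
    (A A' : Matrix (Fin 2) (Fin 2) ℝ) (hA : A * A' = 1) (hA' : A' * A = 1)
    (hπ : ∀ α : Fin s, (π α).val < r.val ↔ α.val < r.val)
    (hlam : ∀ i, lam' i = signedPerm π c (comb lam (A.row i)))
    (hcomb : ∀ ζ, comb lam' (Matrix.vecMul ζ A') = signedPerm π c (comb lam ζ)) :
    TauAlg r lam ≃ₗ⁅ℝ⁆ TauAlg r lam' where
  -- The `Z*`-coordinates transform by the inverse `A'` of the matrix `A` acting on the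
  -- `Z`-coordinates, which preserves their pairing. `W*_α` carries no sign: in its brackets the
  -- sign on `W` meets the sign in `λ'`, and they cancel.
  toFun x := mk (fun β => x.wstar (π.symm β)) (A.mulVec x.z)
    (fun β => ((c β : ℤ) : ℝ) * x.w (π.symm β)) (Matrix.vecMul x.zstar A')
  invFun x := mk (fun α => x.wstar (π α)) (A'.mulVec x.z)
    (fun α => ((c (π α) : ℤ) : ℝ) * x.w (π α)) (Matrix.vecMul x.zstar A)
  map_add' x y := by
    apply TauAlg.ext <;> intro i
    · simp
    · exact congrFun (Matrix.mulVec_add A x.z y.z) i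
    · simp [mul_add]
    · simp [Matrix.add_vecMul]
  map_smul' k x := by
    apply TauAlg.ext <;> intro i
    · simp
    · exact congrFun (Matrix.mulVec_smul A k x.z) i
    · simp [mul_left_comm]
    · simp [Matrix.smul_vecMul]
  map_lie' {x y} := by
    apply TauAlg.ext <;> intro i
    · have h := units_mul_self (c i)
      simp only [wstar_lie_eq, wstar_mk, w_mk, zstar_mk, hcomb, signedPerm_apply]
      linear_combination -(comb lam x.zstar (π.symm i) * y.w (π.symm i) -
        x.w (π.symm i) * comb lam y.zstar (π.symm i)) * h
    · simp only [z_lie, z_mk, wstar_mk, w_mk, Matrix.mulVec, dotProduct, Fin.sum_univ_two,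
        hlam, signedPerm_apply, Finset.mul_sum, ← Finset.sum_add_distrib]
      refine Fintype.sum_equiv π _ _ fun α => ?_
      have h := units_mul_self (c (π α))
      simp only [Equiv.symm_apply_apply, eps_perm hπ, comb_apply, Matrix.row_apply]
      linear_combination (eps r α * (A i 0 * lam 0 α + A i 1 * lam 1 α) *
        (x.wstar α * y.w α - x.w α * y.wstar α)) * h
    · obtain ⟨α, rfl⟩ := π.surjective i
      simp only [w_lie_eq, wstar_mk, w_mk, zstar_mk, hcomb, signedPerm_apply,
        Equiv.symm_apply_apply, eps_perm hπ]
      ring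
    · simp
  left_inv x := by
    apply TauAlg.ext <;> intro i
    · simp
    · simp only [z_mk, Matrix.mulVec_mulVec, hA', Matrix.one_mulVec]
    · simp [← mul_assoc, units_mul_self]
    · simp [Matrix.vecMul_vecMul, hA']
  right_inv x := by
    apply TauAlg.ext <;> intro i
    · simp
    · simp only [z_mk, Matrix.mulVec_mulVec, hA, Matrix.one_mulVec]
    · simp [← mul_assoc, units_mul_self]
    · simp [Matrix.vecMul_vecMul, hA]

theorem isoOfSignedPerm_apply {π : Equiv.Perm (Fin s)} {c : Fin s → ℤˣ}
    {A A' : Matrix (Fin 2) (Fin 2) ℝ} (hA : A * A' = 1) (hA' : A' * A = 1)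
    (hπ : ∀ α : Fin s, (π α).val < r.val ↔ α.val < r.val)
    (hlam : ∀ i, lam' i = signedPerm π c (comb lam (A.row i)))
    (hcomb : ∀ ζ, comb lam' (Matrix.vecMul ζ A') = signedPerm π c (comb lam ζ))
    (x : TauAlg r lam) : isoOfSignedPerm π c A A' hA hA' hπ hlam hcomb x =
      mk (fun β => x.wstar (π.symm β)) (A.mulVec x.z)
        (fun β => ((c β : ℤ) : ℝ) * x.w (π.symm β)) (Matrix.vecMul x.zstar A') := rfl

theorem form_eq_dotProduct (x y : TauAlg r lam) :
    form x y = ∑ α, eps r α * x.wstar α * y.wstar α + ∑ α, x.w α * y.w α +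
      (y.zstar ⬝ᵥ x.z + x.zstar ⬝ᵥ y.z) := by
  rw [form_apply, dotProduct, dotProduct,
    ← Finset.sum_add_distrib (f := fun i => y.zstar i * x.z i)]
  congr 1
  refine Finset.sum_congr rfl fun i _ => ?_
  ring

theorem isomorphic_of_sameOrbit {hlam : NonvanishingRows lam} {hlam' : NonvanishingRows lam'}
    (hfr : Module.finrank ℝ (planeOf lam) = 2)
    (e : SameOrbit r (planeOf lam) (planeOf lam')) :
    (tau r lam hlam).Isomorphic (tau r lam' hlam') := by
  obtain ⟨π, c, hπ, hP⟩ := e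
  have hinj := finrank_planeOf_eq_two_iff.1 hfr
  have h1 : ∀ i, ∃ a, lam' i = signedPerm π c (comb lam a) := fun i => by
    have : lam' i ∈ planeOf lam' := Submodule.subset_span (by fin_cases i <;> simp)
    rw [← hP] at this
    obtain ⟨_, hx, hx'⟩ := this
    obtain ⟨a, rfl⟩ := mem_planeOf.1 hx
    exact ⟨a, hx'.symm⟩
  have h2 : ∀ i, ∃ b, comb lam' b = signedPerm π c (lam i) := fun i => by
    rw [← mem_planeOf, ← hP]
    exact Submodule.mem_map_of_mem (Submodule.subset_span (by fin_cases i <;> simp))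
  obtain ⟨A, hA⟩ : ∃ A : Matrix (Fin 2) (Fin 2) ℝ,
      ∀ i, lam' i = signedPerm π c (comb lam (A.row i)) := by
    choose A hA using h1
    exact ⟨Matrix.of A, hA⟩
  obtain ⟨A', hA'⟩ : ∃ A' : Matrix (Fin 2) (Fin 2) ℝ,
      ∀ i, comb lam' (A'.row i) = signedPerm π c (lam i) := by
    choose A' hA' using h2
    exact ⟨Matrix.of A', hA'⟩
  have e1 : ∀ ζ, comb lam' ζ = signedPerm π c (comb lam (Matrix.vecMul ζ A)) := fun ζ => by
    have : comb lam (Matrix.vecMul ζ A) = ζ 0 • comb lam (A.row 0) + ζ 1 • comb lam (A.row 1) := by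
      rw [← map_smul, ← map_smul, ← map_add]
      congr 1
      ext j
      simp [Matrix.vecMul, dotProduct, Fin.sum_univ_two]
    rw [this, map_add, map_smul, map_smul, ← hA, ← hA]
    rfl
  have e2 : ∀ ζ, comb lam' (Matrix.vecMul ζ A') = signedPerm π c (comb lam ζ) := fun ζ => by
    have : Matrix.vecMul ζ A' = ζ 0 • A'.row 0 + ζ 1 • A'.row 1 := by
      ext j
      simp [Matrix.vecMul, dotProduct, Fin.sum_univ_two]
    rw [this, map_add, map_smul, map_smul, hA', hA', ← map_smul, ← map_smul, ← map_add]
    rfl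
  -- `A` and `A'` express `λ'` and the transformed `λ` in terms of each other; independence of `λ_1,
  -- λ_2` makes them inverse.
  have hAA : A' * A = 1 := by
    ext i j
    have h := e1 (Matrix.vecMul (Pi.single i 1) A')
    rw [e2] at h
    have h' := hinj (Matrix.vecMul (Matrix.vecMul (Pi.single i 1) A') A - Pi.single i 1) (by
      rw [map_sub, sub_eq_zero]
      exact (signedPerm_injective π c h).symm)
    rw [sub_eq_zero, Matrix.vecMul_vecMul] at h'
    have := congrFun h' j
    rw [Matrix.single_one_vecMul] at this
    rw [Matrix.one_apply]
    simpa [Pi.single_apply, eq_comm] using this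
  have hAA' : A * A' = 1 := mul_eq_one_comm.1 hAA
  refine ⟨isoOfSignedPerm π c A A' hAA' hAA hπ hA e2,
    fun x => ?_, fun x y => ?_⟩
  · change _ = sigma _
    apply TauAlg.ext <;> intro i
    · rfl
    · exact congrFun (Matrix.mulVec_neg x.z A) i
    · exact mul_neg _ _
    · exact congrFun (Matrix.neg_vecMul x.zstar A') i
  · change form _ _ = form _ _
    rw [form_eq_dotProduct, form_eq_dotProduct]
    simp only [isoOfSignedPerm_apply, wstar_mk, z_mk, w_mk, zstar_mk]
    congr 1
    · congr 1
      · refine (Fintype.sum_equiv π _ _ fun α => ?_).symm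
        simp only [Equiv.symm_apply_apply, eps_perm hπ]
      · refine (Fintype.sum_equiv π _ _ fun α => ?_).symm
        simp only [Equiv.symm_apply_apply]
        linear_combination -(x.w α * y.w α) * units_mul_self (c (π α))
    · rw [← Matrix.dotProduct_mulVec, ← Matrix.dotProduct_mulVec, Matrix.mulVec_mulVec,
        Matrix.mulVec_mulVec, hAA, Matrix.one_mulVec, Matrix.one_mulVec]

end Isomorphism

end SymTriples

/-! ### The bijection. -/

open SymTriples in
theorem mainTheorem5 (n : ℕ) (hn : 4 ≤ n) :
    (∃ Ψ : IsoClass (n - 4) ≃ Moduli (n - 4),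
      (∀ p : IndecParam (n - 4), ∃ hP : Admissible (planeOf p.lam),
        Ψ (Quotient.mk (isoSetoid (n - 4)) p) = Moduli.mk p.r (planeOf p.lam) hP) ∧
      (∀ (r : Fin (n - 4 + 1)) (P : Submodule ℝ (EuclideanSpace ℝ (Fin (n - 4))))
        (hP : Admissible P) (lam : Fin 2 → EuclideanSpace ℝ (Fin (n - 4))),
        planeOf lam = P →
          ∃ (hlam : NonvanishingRows lam) (hind : (tau r lam hlam).Indecomposable),
            Ψ.symm (Moduli.mk r P hP) =
              Quotient.mk (isoSetoid (n - 4)) ⟨r, lam, hlam, hind⟩)) ∧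
    (Nonempty (IndecParam (n - 4)) → 6 < n) := by
  have hadm : ∀ p : IndecParam (n - 4), Admissible (planeOf p.lam) := fun p =>
    admissible_of_indecomposable p.nonvanishing p.indecomposable
  refine ⟨?_, fun ⟨p⟩ => by have := (hadm p).three_le; omega⟩
  let f : IsoClass (n - 4) → Moduli (n - 4) := Quotient.lift
    (fun p : IndecParam (n - 4) => Moduli.mk p.r (planeOf p.lam) (hadm p)) (by
      rintro ⟨r, lam, hlam, hind⟩ ⟨r', lam', hlam', hind'⟩ e
      obtain ⟨π, c, hπ, hP⟩ := exists_perm_of_isomorphic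
        (hadm ⟨r, lam, hlam, hind⟩).1 (hadm ⟨r', lam', hlam', hind'⟩).1 e
      -- Once `r = r'`, the permutation preserves the first `r` indices, and both planes lie over
      -- the same `r`.
      obtain rfl := eq_of_perm hπ
      exact congrArg (Sigma.mk r) (Quotient.sound ⟨π, c, hπ, hP⟩))
  have hf : Function.Bijective f := by
    constructor
    · rintro ⟨r, lam, hlam, hind⟩ ⟨r', lam', hlam', hind'⟩ e
      change Moduli.mk r (planeOf lam) (hadm ⟨r, lam, hlam, hind⟩) =
        Moduli.mk r' (planeOf lam') (hadm ⟨r', lam', hlam', hind'⟩) at e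
      obtain ⟨rfl, e'⟩ := Sigma.mk.inj e
      exact Quotient.sound (isomorphic_of_sameOrbit (hadm ⟨r, lam, hlam, hind⟩).1
        (Quotient.exact (eq_of_heq e')))
    · rintro ⟨r, ⟨P, hP⟩⟩
      obtain ⟨lam, rfl⟩ := exists_planeOf_eq hP.1
      exact ⟨Quotient.mk _ ⟨r, lam, hP.nonvanishingRows, hP.indecomposable _⟩, rfl⟩
  refine ⟨Equiv.ofBijective f hf, fun p => ⟨hadm p, rfl⟩, ?_⟩
  rintro r _ hP lam rfl
  refine ⟨hP.nonvanishingRows, hP.indecomposable _, ?_⟩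
  rw [Equiv.symm_apply_eq]
  rfl
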